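/- Let $\mathcal A$ (students), $\mathcal I$ (schools) and $\mathcal T$ (traits) be finite sets and let the set of contracts be $\mathcal X=\mathcal A\times\mathcal I$; for $x=(a,i)$ write $\alpha(x)=a$, and write $\mathcal X_i=\mathcal A\times\{i\}$. Each school $i$ has a priority order $\succ_i$ (a linear order) on $\mathcal X_i$, a capacity $q_i\in\mathbb N=\{0,1,2,\dots\}$, a set $\mathcal X_i^{ge}\subseteq\mathcal X_i$ of contracts with its returning students, $|\mathcal X_i^{ge}|\le q_i$, and numbers $r_i^t\in\mathbb N$ ($t\in\mathcal T$) of seats reserved for trait $t$. Each student $a$ has a set of traits $\tau(a)\subseteq\mathcal T$. For $Y\subseteq\mathcal X_i$ let $r_i(Y)$ be the rank of $Y$ in the transversal matroid of school $i$, that is, the largest number of students with contracts in $Y$ that can be assigned to distinct reserved seats of $i$, each student to a seat reserved for one of the student's traits. A problem $R=(R_a)_{a\in\mathcal A}$ consists of a linear order $R_a$ on $\mathcal X_a\cup\{\emptyset\}$ for each student $a$, where $\mathcal X_a=\{a\}\times\mathcal I$ and $\emptyset$ is the null contract; $P_a$ is the strict part of $R_a$. A matching is a set $X\subseteq\mathcal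 X$ that contains at most one contract of each student; $X_i=X\cap\mathcal X_i$, and $X_a$ is the contract of $a$ in $X$, or $\emptyset$. A matching rule $\varphi$ assigns a matching $\varphi(R)$ to each problem $R$, and $\varphi$ satisfies a property of matchings if $\varphi(R)$ satisfies it at $R$ for every problem $R$. Consider the following properties of a matching $X$ at $R$. * Guaranteed enrollment for returning students: for all $i$ and $x\in\mathcal X_i^{ge}\setminus X_i$, $X_{\alpha(x)}\mathrel{P_{\alpha(x)}}x$. * Maximal utilization of reservations: for all $i$ and $x\in\mathcal X_i\setminus X_i$ with $x\mathrel{P_{\alpha(x)}}X_{\alpha(x)}$, if $|X_i|<q_i$ then $r_i(X_i\cup\{x\})=r_i(X_i)$, and if $|X_i|=q_i$ then $r_i((X_i\setminus\{y\})\cup\{x\})\le r_i(X_i)$ for every $y\in X_i\setminus\mathcal X_i^{ge}$. * No justified envy under reserves: for all $i$, all $x\in\mathcal X_i\setminus X_i$ with $x\mathrel{P_{\alpha(x)}}X_{\alpha(x)}$ and all $y\in X_i\setminus\mathcal X_i^{ge}$, if $x\succ_i y$ then $r_i((X_i\setminus\{y\})\cup\{x\})<r_i(X_i)$. * Non-wastefulness: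 for all $i$, $|X_i|\le q_i$, and $|X_i|=q_i$ whenever some $x\in\mathcal X_i$ has $x\mathrel{P_{\alpha(x)}}X_{\alpha(x)}$. * Individual rationality: $X_a\mathrel{R_a}\emptyset$ for all $a$. The rule $\varphi$ is strategy-proof if $\varphi(R)_a\mathrel{R_a}\varphi(R'_a,R_{-a})_a$ for every problem $R$, every student $a$ and every alternative preference $R'_a$ of $a$. The guaranteed-enrollment choice rule $C_i^{ge}$ chooses from each $Y\subseteq\mathcal X_i$ as follows. (1) Choose all contracts in $Y\cap\mathcal X_i^{ge}$. (2) As long as fewer than $q_i$ contracts are chosen and some unchosen contract in $Y$ increases the rank $r_i$ of the set chosen so far, add the $\succ_i$-highest such contract. (3) Then add the remaining contracts of $Y$ in order of priority until $q_i$ contracts, or all of $Y$, are chosen. The deferred-acceptance (DA) rule based on choice rules $(C_i)_{i\in\mathcal I}$ is computed as follows: at each step, each student whose contract is not tentatively accepted proposes the most preferred acceptable contract that has not been rejected so far (or is assigned $\emptyset$ if there is none); each school $i$ tentatively accepts $C_i(Y)$ and permanently rejects $Y\setminus C_i(Y)$, where $Y$ consists of its tentatively accepted contracts and the new proposals to it.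 The algorithm stops at the first step without a rejection and returns the accepted contracts. Then a matching rule satisfies guaranteed enrollment for returning students, maximal utilization of reservations, no justified envy under reserves, non-wastefulness, individual rationality and strategy-proofness if and only if it is the DA rule based on $C^{ge}=(C_i^{ge})_{i\in\mathcal I}$. -/

import Mathlib

open scoped Classical

noncomputable section

namespace SchoolChoice

/-- A linear order on `S`, read as a ranking: `p.rel x y` says that `x` is ranked weakly above
`y`. -/
structure Ranking (S : Type*) where
  rel : S → S → Prop
  antisymm : ∀ x y, rel x y → rel y x → x = y
  trans : ∀ x y z, rel x y → rel y z → rel x z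
  total : ∀ x y, rel x y ∨ rel y x

/-- `x` is ranked strictly above `y`. -/
def Ranking.strict {S : Type*} (p : Ranking S) (x y : S) : Prop :=
  p.rel x y ∧ x ≠ y

theorem Ranking.exists_best {S : Type*} (p : Ranking S) (X : Finset S) (hX : X.Nonempty) :
    ∃ x ∈ X, ∀ y ∈ X, p.rel x y := by
  induction hX using Finset.Nonempty.cons_induction with
  | singleton a => exact ⟨a, by simp, by simpa using p.total a a⟩
  | cons a s _ _ ih =>
    obtain ⟨b, hb, hbs⟩ := ih
    have haa : p.rel a a := by simpa using p.total a a
    rcases p.total a b with h | h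
    · refine ⟨a, by simp, fun y hy => ?_⟩
      rcases Finset.mem_cons.1 hy with rfl | hy
      · exact haa
      · exact p.trans _ _ _ h (hbs y hy)
    · refine ⟨b, by simp [hb], fun y hy => ?_⟩
      rcases Finset.mem_cons.1 hy with rfl | hy
      · exact h
      · exact hbs y hy

/-- The highest ranked element of a nonempty finite set. -/
def Ranking.best {S : Type*} (p : Ranking S) (X : Finset S) (hX : X.Nonempty) : S :=
  (p.exists_best X hX).choose

theorem Ranking.best_mem {S : Type*} (p : Ranking S) (X : Finset S) (hX : X.Nonempty) :
    p.best X hX ∈ X :=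
  (p.exists_best X hX).choose_spec.1

theorem Ranking.best_rel {S : Type*} (p : Ranking S) (X : Finset S) (hX : X.Nonempty) :
    ∀ y ∈ X, p.rel (p.best X hX) y :=
  (p.exists_best X hX).choose_spec.2

/-! ### Problems, matchings, choice rules

The contracts are the pairs of a student `a : A` and a school `i : I`.  The contracts of a fixed
student `a` are identified with the schools, and the contracts of a fixed school `i` with the
students. -/

/-- A matching problem: every student ranks the schools and the null contract `none`. -/
abbrev Problem (A I : Type*) := A → Ranking (Option I)

/-- A matching: a set of student-school pairs with at most one pair for each student, given by
the assignment of each student (`none` when the student has no pair in the set). -/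
abbrev Matching (A I : Type*) := A → Option I

/-- The set of students matched with school `i`. -/
def Matching.at {A I : Type*} [Fintype A] (μ : Matching A I) (i : I) : Finset A :=
  Finset.univ.filter fun a => μ a = some i

/-- A choice rule of a school: it selects a subset of any given set of applicants. -/
structure ChoiceRule (A : Type*) where
  choice : Finset A → Finset A
  subset : ∀ X, choice X ⊆ X

/-! ### The deferred-acceptance rule

Tentatively accepted contracts are proposed again at the next step: a contract that is held by a
school is still the most preferred one of its student among those not rejected so far. -/

section DA

variable {A I : Type*} [Fintype A] [Fintype I]

/-- The proposal of student `a` when `rej` is the set of the contracts rejected so far: the most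
preferred acceptable contract outside `rej`, or `none` if there is no such contract. -/
def proposal (R : Problem A I) (rej : Finset (A × I)) (a : A) : Option I :=
  (R a).best (insert none ((Finset.univ.filter fun i => (a, i) ∉ rej).image some))
    (Finset.insert_nonempty _ _)

/-- The students considered by school `i` when `rej` is the set of contracts rejected so far. -/
def considered (R : Problem A I) (rej : Finset (A × I)) (i : I) : Finset A :=
  Matching.at (proposal R rej) i

/-- The contracts that are rejected at the step that starts with the rejected set `rej`. -/
def newRejections (C : I → ChoiceRule A) (R : Problem A I) (rej : Finset (A × I)) :
    Finset (A × I) :=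
  Finset.univ.filter fun x =>
    x.1 ∈ considered R rej x.2 \ (C x.2).choice (considered R rej x.2)

/-- The contracts rejected at the first `s` steps of the deferred-acceptance algorithm. -/
def rejected (C : I → ChoiceRule A) (R : Problem A I) : ℕ → Finset (A × I)
  | 0 => ∅
  | s + 1 => rejected C R s ∪ newRejections C R (rejected C R s)

/-- The contracts accepted at the step that starts with the rejected set `rej`. -/
def accepted (C : I → ChoiceRule A) (R : Problem A I) (rej : Finset (A × I)) : Matching A I :=
  fun a => (proposal R rej a).bind fun i =>
    if a ∈ (C i).choice (considered R rej i) then some i else none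

/-- The deferred-acceptance rule based on `C`: the acceptances at the last step.  After
`card (A × I)` steps there are no further rejections (`newRejections_rejected_card`), and from
the first step without rejections on nothing changes. -/
def deferredAcceptance (C : I → ChoiceRule A) : Problem A I → Matching A I :=
  fun R => accepted C R (rejected C R (Fintype.card (A × I)))

theorem disjoint_newRejections (C : I → ChoiceRule A) (R : Problem A I) (rej : Finset (A × I)) :
    Disjoint rej (newRejections C R rej) := by
  rw [Finset.disjoint_right]
  rintro ⟨a, i⟩ hx
  have h : proposal R rej a = some i := by
    simp only [newRejections, considered, Matching.at, Finset.mem_filter, Finset.mem_sdiff] at hx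
    exact hx.2.1.2
  have hm := (R a).best_mem
    (insert none ((Finset.univ.filter fun i => (a, i) ∉ rej).image some))
    (Finset.insert_nonempty _ _)
  change proposal R rej a ∈ _ at hm
  rw [h] at hm
  simpa using hm

theorem newRejections_rejected_card (C : I → ChoiceRule A) (R : Problem A I) :
    newRejections C R (rejected C R (Fintype.card (A × I))) = ∅ := by
  have key : ∀ s, newRejections C R (rejected C R s) = ∅ ∨ s ≤ (rejected C R s).card := by
    intro s
    induction s with
    | zero => right; simp
    | succ s ih =>
      by_cases h0 : newRejections C R (rejected C R s) = ∅
      · left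
        have : rejected C R (s + 1) = rejected C R s := by simp [rejected, h0]
        rw [this, h0]
      · right
        have h1 := ih.resolve_left h0
        have h2 := Finset.card_union_of_disjoint (disjoint_newRejections C R (rejected C R s))
        have h3 := Finset.card_pos.2 (Finset.nonempty_iff_ne_empty.2 h0)
        change s + 1 ≤ (rejected C R s ∪ newRejections C R (rejected C R s)).card
        omega
  rcases key (Fintype.card (A × I)) with h | h
  · exact h
  · have hu : rejected C R (Fintype.card (A × I)) = Finset.univ :=
      (Finset.card_eq_iff_eq_univ _).1 (le_antisymm (Finset.card_le_univ _) h)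
    have hd := disjoint_newRejections C R (rejected C R (Fintype.card (A × I)))
    rw [hu] at hd ⊢
    exact Finset.disjoint_left.1 hd |> fun h' =>
      Finset.eq_empty_of_forall_notMem fun x => h' (Finset.mem_univ x)

end DA

/-! ### The Chilean school-choice setting -/

/-- Students `A`, schools `I`, traits `T`. -/
structure Market (A I T : Type*) where
  /-- the priority order of each school over its contracts -/
  priority : I → Ranking A
  capacity : I → ℕ
  /-- the returning students of each school -/
  returning : I → Finset A
  card_returning_le : ∀ i, (returning i).card ≤ capacity i
  /-- the traits that each student has -/
  traits : A → Set T
  /-- the number of seats that each school reserves for each trait -/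
  reserve : I → T → ℕ

namespace Market

variable {A I T : Type*} (M : Market A I T)

/-- The reserved seats of school `i`: there are `reserve i t` of them for each trait `t`. -/
abbrev Seat (i : I) := Σ t : T, Fin (M.reserve i t)

/-- The independent sets of the transversal matroid of school `i`: the sets of students that can
be assigned to different reserved seats, each to a seat reserved for a trait of theirs. -/
def Indep (i : I) (X : Finset A) : Prop :=
  ∃ f : {a // a ∈ X} → M.Seat i, Function.Injective f ∧ ∀ a, (f a).1 ∈ M.traits a.1

/-- The rank function of that matroid: the largest size of an independent subset. -/
def rank (i : I) (X : Finset A) : ℕ :=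
  (X.powerset.filter fun Y => M.Indep i Y).sup Finset.card

/-- One seat of Step 2 of the guaranteed-enrollment choice rule, at the choice problem `X` when
`Y` has been chosen so far: unless the capacity is reached, the highest priority contract of `X`
that increases the reserve utilization is added, if there is one. -/
def reserveStep (i : I) (X Y : Finset A) : Finset A :=
  if h : Y.card < M.capacity i ∧
      ((X \ Y).filter fun a => M.rank i (insert a Y) = M.rank i Y + 1).Nonempty then
    insert ((M.priority i).best _ h.2) Y
  else Y

/-- One seat of Step 3: unless the capacity is reached, the highest priority contract of `X` that
is not yet chosen is added, if there is one. -/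
def fillStep (i : I) (X Y : Finset A) : Finset A :=
  if h : Y.card < M.capacity i ∧ (X \ Y).Nonempty then
    insert ((M.priority i).best _ h.2) Y
  else Y

theorem reserveStep_subset (i : I) {X Y : Finset A} (h : Y ⊆ X) : M.reserveStep i X Y ⊆ X := by
  unfold reserveStep
  split_ifs with hc
  · refine Finset.insert_subset ?_ h
    exact (Finset.mem_sdiff.1 (Finset.mem_filter.1 ((M.priority i).best_mem _ hc.2)).1).1
  · exact h

theorem fillStep_subset (i : I) {X Y : Finset A} (h : Y ⊆ X) : M.fillStep i X Y ⊆ X := by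
  unfold fillStep
  split_ifs with hc
  · refine Finset.insert_subset ?_ h
    exact (Finset.mem_sdiff.1 ((M.priority i).best_mem _ hc.2)).1
  · exact h

theorem iterate_subset {X : Finset A} {f : Finset A → Finset A}
    (hf : ∀ Y, Y ⊆ X → f Y ⊆ X) (n : ℕ) {Y : Finset A} (h : Y ⊆ X) : f^[n] Y ⊆ X := by
  induction n with
  | zero => exact h
  | succ n ih => rw [Function.iterate_succ_apply']; exact hf _ ih

/-- The guaranteed-enrollment choice rule of school `i`: first the returning students among the
applicants, then one run of `reserveStep` for each reserved seat, then `fillStep` until the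
capacity is reached or all applicants are chosen (more than `X.card` runs never change
anything). -/
def geChoice [Fintype T] (i : I) : ChoiceRule A where
  choice X := (M.fillStep i X)^[X.card]
    ((M.reserveStep i X)^[∑ t, M.reserve i t] (X ∩ M.returning i))
  subset _ := iterate_subset (fun _ => M.fillStep_subset i) _
    (iterate_subset (fun _ => M.reserveStep_subset i) _ Finset.inter_subset_left)

/-! ### The matching axioms, for a matching `μ` at a problem `R` -/

variable [Fintype A]

/-- Guaranteed enrollment for returning students. -/
def GuaranteedEnrollment (R : Problem A I) (μ : Matching A I) : Prop :=
  ∀ i, ∀ a ∈ M.returning i, a ∉ μ.at i → (R a).strict (μ a) (some i)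

/-- Maximal utilization of reservations. -/
def MaximalUtilization (R : Problem A I) (μ : Matching A I) : Prop :=
  ∀ i, ∀ a ∉ μ.at i, (R a).strict (some i) (μ a) →
    ((μ.at i).card < M.capacity i → M.rank i (μ.at i ∪ {a}) = M.rank i (μ.at i)) ∧
    ((μ.at i).card = M.capacity i →
      ∀ b ∈ μ.at i \ M.returning i, M.rank i ((μ.at i \ {b}) ∪ {a}) ≤ M.rank i (μ.at i))

/-- No justified envy under reserves. -/
def NoJustifiedEnvyUnderReserves (R : Problem A I) (μ : Matching A I) : Prop :=
  ∀ i, ∀ a ∉ μ.at i, (R a).strict (some i) (μ a) →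
    ∀ b ∈ μ.at i \ M.returning i, (M.priority i).strict a b →
      M.rank i ((μ.at i \ {b}) ∪ {a}) < M.rank i (μ.at i)

/-- Non-wastefulness. -/
def NonWasteful (R : Problem A I) (μ : Matching A I) : Prop :=
  ∀ i, (μ.at i).card ≤ M.capacity i ∧
    ∀ a, (R a).strict (some i) (μ a) → (μ.at i).card = M.capacity i

end Market

/-- Individual rationality of a matching at `R`. -/
def IndividuallyRational {A I : Type*} (R : Problem A I) (μ : Matching A I) : Prop :=
  ∀ a, (R a).rel (μ a) none

/-- Strategy-proofness of a matching rule. -/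
def StrategyProof {A I : Type*} (φ : Problem A I → Matching A I) : Prop :=
  ∀ (R : Problem A I) (a : A) (p : Ranking (Option I)),
    (R a).rel (φ R a) (φ (Function.update R a p) a)

end SchoolChoice

end

open SchoolChoice

/-!
The axioms other than individual rationality and strategy-proofness say exactly that each school's
students are an exchange-optimal choice from the demand for it: returning students come first, and
no exchange of a single student improves the use of the reserves or, at equal use, the priorities.
A symmetric exchange property of matroid rank functions shows that there is at most one
exchange-optimal choice, and that choices of this kind are substitutable and size monotone. The
guaranteed-enrollment choice rule, a greedy algorithm, finds it. Hence the axioms say that the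
rule is strategy-proof and stable with respect to `C^ge`.

For substitutable and size monotone choice rules, deferred acceptance finds the stable matching that
is best for all students, and all stable matchings match the same students. If deferred acceptance
gives student `a` school `i`, then it is still stable for `a` to get `i` after declaring only `i`
acceptable; so every stable rule gives `i` after this report, and strategy-proofness forces it to
give `a` at least `i` at the true preferences.
-/

noncomputable section

namespace SchoolChoice

/-! ### Stability and deferred acceptance -/

namespace Ranking

section Order

variable {S : Type*} (p : Ranking S) {x y : S}

theorem refl (x : S) : p.rel x x := or_self_iff.1 (p.total x x)

theorem rel_of_not_rel (h : ¬ p.rel x y) : p.rel y x := (p.total x y).resolve_left h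

variable {p} in
theorem strict.not_rel (h : p.strict x y) : ¬ p.rel y x := fun h' => h.2 (p.antisymm x y h.1 h')

/-- The ranking that places the members of `U` on top and otherwise keeps the order of `p`. -/
def promote (U : Set S) : Ranking S where
  rel x y := (x ∈ U ∧ y ∉ U) ∨ ((x ∈ U ↔ y ∈ U) ∧ p.rel x y)
  antisymm x y _ _ := by
    have := p.antisymm x y
    tauto
  trans x y z _ _ := by
    have := p.trans x y z
    tauto
  total x y := by
    have := p.total x y
    tauto

end Order

section Shortlist

variable {I : Type*} (p : Ranking (Option I)) {U : Set I} {i j : I}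

/-- The preference that makes exactly the schools of `U` acceptable and ranks them in the order of
`p`. Misreports of this form are what strategy-proofness is tested against. -/
def shortlist (U : Set I) : Ranking (Option I) :=
  (p.promote {none}).promote (some '' U)

theorem shortlist_rel_none : (p.shortlist U).rel (some i) none ↔ i ∈ U := by
  simp [shortlist, promote]

theorem shortlist_rel_some (hj : j ∈ U) :
    (p.shortlist U).rel (some i) (some j) ↔ i ∈ U ∧ p.rel (some i) (some j) := by
  simp [shortlist, promote, hj]

end Shortlist

end Ranking

namespace ChoiceRule

variable {A : Type*} {c : ChoiceRule A}

/-- Substitutability of a choice rule: a student chosen from a set is chosen from each of its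
subsets that contain the student. -/
def Substitutable (c : ChoiceRule A) : Prop :=
  ∀ ⦃X Y : Finset A⦄, X ⊆ Y → c.choice Y ∩ X ⊆ c.choice X

/-- Size monotonicity of a choice rule, also called the law of aggregate demand: at least as many
students are chosen from a larger set. -/
def SizeMonotone (c : ChoiceRule A) : Prop :=
  ∀ ⦃X Y : Finset A⦄, X ⊆ Y → (c.choice X).card ≤ (c.choice Y).card

theorem Substitutable.notMem_choice {X Y : Finset A} {a : A} (hs : c.Substitutable) (hXY : X ⊆ Y)
    (haX : a ∈ X) (ha : a ∉ c.choice X) : a ∉ c.choice Y := fun haY =>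
  ha (hs hXY (Finset.mem_inter.2 ⟨haY, haX⟩))

theorem choice_eq_of_subset (hs : c.Substitutable) (hm : c.SizeMonotone) {X Y : Finset A}
    (hXY : X ⊆ Y) (h : c.choice Y ⊆ X) : c.choice X = c.choice Y := by
  have hsub : c.choice Y ⊆ c.choice X := by simpa only [Finset.inter_eq_left.2 h] using hs hXY
  exact (Finset.eq_of_subset_of_card_le hsub (hm hXY)).symm

end ChoiceRule

section Stability

variable {A I : Type*} [Fintype A] {C : I → ChoiceRule A} {R R' : Problem A I} {μ ν : Matching A I}
  {a : A} {i : I}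

theorem Matching.mem_at : a ∈ μ.at i ↔ μ a = some i := by
  simp [Matching.at]

/-- The demand for school `i` at the matching `μ`: the students who rank it weakly above their
assignments. -/
def demand (R : Problem A I) (μ : Matching A I) (i : I) : Finset A :=
  Finset.univ.filter fun a => (R a).rel (some i) (μ a)

theorem mem_demand : a ∈ demand R μ i ↔ (R a).rel (some i) (μ a) := by
  simp [demand]

theorem at_subset_demand (R : Problem A I) (μ : Matching A I) (i : I) :
    μ.at i ⊆ demand R μ i := fun a ha =>
  mem_demand.2 (Matching.mem_at.1 ha ▸ (R a).refl _)

theorem mem_demand_sdiff_at :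
    a ∈ demand R μ i \ μ.at i ↔ (R a).strict (some i) (μ a) := by
  rw [Finset.mem_sdiff, mem_demand, Matching.mem_at, Ranking.strict, ne_comm]

theorem demand_subset_demand (h : ∀ b, (R b).rel (μ b) (ν b)) (i : I) :
    demand R μ i ⊆ demand R ν i := fun b hb =>
  mem_demand.2 ((R b).trans _ _ _ (mem_demand.1 hb) (h b))

/-- Stability of a matching under the choice rules `C`: it is individually rational, and each school
is matched with its choice from the demand for it. The second condition rules out blocking
contracts. -/
def Stable (C : I → ChoiceRule A) (R : Problem A I) (μ : Matching A I) : Prop :=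
  IndividuallyRational R μ ∧ ∀ i, (C i).choice (demand R μ i) = μ.at i

theorem Stable.of_demand_subset (hs : ∀ i, (C i).Substitutable) (hm : ∀ i, (C i).SizeMonotone)
    (h : Stable C R μ) (hir : IndividuallyRational R' μ)
    (hd : ∀ i, demand R' μ i ⊆ demand R μ i) : Stable C R' μ := by
  refine ⟨hir, fun i => ?_⟩
  rw [ChoiceRule.choice_eq_of_subset (hs i) (hm i) (hd i), h.2 i]
  exact (h.2 i).trans_subset (at_subset_demand R' μ i)

theorem Stable.update (hs : ∀ i, (C i).Substitutable) (hm : ∀ i, (C i).SizeMonotone)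
    {p : Ranking (Option I)} (h : Stable C R μ) (hir : p.rel (μ a) none)
    (hd : ∀ i, p.rel (some i) (μ a) → (R a).rel (some i) (μ a)) :
    Stable C (Function.update R a p) μ := by
  refine h.of_demand_subset hs hm (fun b => ?_) fun i b hb => ?_
  · rcases eq_or_ne b a with rfl | hba
    · rwa [Function.update_self]
    · rw [Function.update_of_ne hba]
      exact h.1 b
  · rw [mem_demand] at hb ⊢
    rcases eq_or_ne b a with rfl | hba
    · exact hd i (by rwa [Function.update_self] at hb)
    · rwa [Function.update_of_ne hba] at hb

end Stability

section Proposal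

variable {A I : Type*} [Fintype I] (R : Problem A I) {rej rej' : Finset (A × I)} {a : A} {i : I}

theorem proposal_eq_none_or (rej : Finset (A × I)) (a : A) :
    proposal R rej a = none ∨ ∃ i, (a, i) ∉ rej ∧ proposal R rej a = some i := by
  have h : proposal R rej a ∈ _ := (R a).best_mem _ _
  simpa only [Finset.mem_insert, Finset.mem_image, Finset.mem_filter, Finset.mem_univ, true_and,
    eq_comm (b := proposal R rej a)] using h

theorem proposal_rel_none (rej : Finset (A × I)) (a : A) : (R a).rel (proposal R rej a) none :=
  (R a).best_rel _ _ _ (by simp)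

theorem proposal_rel_some (h : (a, i) ∉ rej) : (R a).rel (proposal R rej a) (some i) :=
  (R a).best_rel _ _ _ (by simp [h])

theorem proposal_anti (h : rej ⊆ rej') (a : A) :
    (R a).rel (proposal R rej a) (proposal R rej' a) := by
  rcases proposal_eq_none_or R rej' a with hnone | ⟨i, hi, hsome⟩
  · rw [hnone]
    exact proposal_rel_none R rej a
  · rw [hsome]
    exact proposal_rel_some R fun hm => hi (h hm)

end Proposal

section DeferredAcceptance

variable {A I : Type*} [Fintype A] [Fintype I] {C : I → ChoiceRule A} {R : Problem A I}
  {rej : Finset (A × I)} {μ ν : Matching A I} {a : A} {i : I}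

theorem mem_considered : a ∈ considered R rej i ↔ proposal R rej a = some i := Matching.mem_at

theorem mem_newRejections :
    (a, i) ∈ newRejections C R rej ↔
      a ∈ considered R rej i ∧ a ∉ (C i).choice (considered R rej i) := by
  simp [newRejections]

theorem mem_rejected_succ {s : ℕ} :
    (a, i) ∈ rejected C R (s + 1) ↔
      (a, i) ∈ rejected C R s ∨ (a, i) ∈ newRejections C R (rejected C R s) :=
  Finset.mem_union

theorem rejected_subset_succ (C : I → ChoiceRule A) (R : Problem A I) (s : ℕ) :
    rejected C R s ⊆ rejected C R (s + 1) := Finset.subset_union_left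

theorem rel_proposal_of_mem_rejected {s : ℕ} (h : (a, i) ∈ rejected C R s) :
    (R a).rel (some i) (proposal R (rejected C R s) a) := by
  induction s with
  | zero => exact absurd h (Finset.notMem_empty _)
  | succ s ih =>
    have hp := proposal_anti R (rejected_subset_succ C R s) a
    rcases mem_rejected_succ.1 h with h | h
    · exact (R a).trans _ _ _ (ih h) hp
    · rwa [mem_considered.1 (mem_newRejections.1 h).1] at hp

theorem mem_demand_proposal {s : ℕ} :
    a ∈ demand R (proposal R (rejected C R s)) i ↔
      a ∈ considered R (rejected C R s) i ∨ (a, i) ∈ rejected C R s := by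
  rw [mem_demand, mem_considered]
  refine ⟨fun h => ?_, ?_⟩
  · by_cases hr : (a, i) ∈ rejected C R s
    · exact Or.inr hr
    · exact Or.inl ((R a).antisymm _ _ (proposal_rel_some R hr) h)
  · rintro (h | h)
    · exact h ▸ (R a).refl _
    · exact rel_proposal_of_mem_rejected h

theorem considered_subset_demand_proposal (C : I → ChoiceRule A) (R : Problem A I) (s : ℕ) (i : I) :
    considered R (rejected C R s) i ⊆ demand R (proposal R (rejected C R s)) i := fun _ ha =>
  mem_demand_proposal.2 (Or.inl ha)

theorem notMem_choice_of_mem_rejected (hs : ∀ i, (C i).Substitutable) {s : ℕ}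
    (h : (a, i) ∈ rejected C R s) :
    a ∉ (C i).choice (demand R (proposal R (rejected C R s)) i) := by
  induction s with
  | zero => exact absurd h (Finset.notMem_empty _)
  | succ s ih =>
    have hmono := demand_subset_demand (proposal_anti R (rejected_subset_succ C R s)) i
    rcases mem_rejected_succ.1 h with h | h
    · exact (hs i).notMem_choice hmono (mem_demand_proposal.2 (Or.inr h)) (ih h)
    · obtain ⟨ha, hchoice⟩ := mem_newRejections.1 h
      exact (hs i).notMem_choice ((considered_subset_demand_proposal C R s i).trans hmono) ha
        hchoice

theorem choice_considered_of_newRejections_eq_empty (h : newRejections C R rej = ∅) (i : I) :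
    (C i).choice (considered R rej i) = considered R rej i := by
  refine Finset.Subset.antisymm ((C i).subset _) fun a ha => ?_
  by_contra hc
  exact Finset.notMem_empty _ (h ▸ mem_newRejections.2 ⟨ha, hc⟩)

theorem deferredAcceptance_eq_proposal (C : I → ChoiceRule A) (R : Problem A I) :
    deferredAcceptance C R = proposal R (rejected C R (Fintype.card (A × I))) := by
  funext a
  have h := choice_considered_of_newRejections_eq_empty (newRejections_rejected_card C R)
  unfold deferredAcceptance accepted
  rcases hp : proposal R (rejected C R (Fintype.card (A × I))) a with _ | i
  · rfl
  · simp only [Option.bind_some, h i, mem_considered.2 hp, if_true]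

theorem stable_deferredAcceptance (hs : ∀ i, (C i).Substitutable)
    (hm : ∀ i, (C i).SizeMonotone) (R : Problem A I) : Stable C R (deferredAcceptance C R) := by
  rw [deferredAcceptance_eq_proposal]
  refine ⟨proposal_rel_none R _, fun i => ?_⟩
  have hsub := considered_subset_demand_proposal C R (Fintype.card (A × I)) i
  rw [← ChoiceRule.choice_eq_of_subset (hs i) (hm i) hsub fun a ha => ?_]
  · exact choice_considered_of_newRejections_eq_empty (newRejections_rejected_card C R) i
  · exact (mem_demand_proposal.1 ((C i).subset _ ha)).resolve_right fun hr =>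
      notMem_choice_of_mem_rejected hs hr ha

theorem Stable.ne_of_mem_rejected (hs : ∀ i, (C i).Substitutable) (hν : Stable C R ν) {s : ℕ}
    (h : (a, i) ∈ rejected C R s) : ν a ≠ some i := by
  induction s generalizing a i with
  | zero => exact absurd h (Finset.notMem_empty _)
  | succ s ih =>
    rcases mem_rejected_succ.1 h with h | h
    · exact ih h
    obtain ⟨ha, hchoice⟩ := mem_newRejections.1 h
    have hsub : considered R (rejected C R s) i ⊆ demand R ν i := fun b hb => by
      rw [mem_demand, ← mem_considered.1 hb]
      rcases hνb : ν b with _ | j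
      · exact proposal_rel_none R _ b
      · exact proposal_rel_some R fun hr => ih hr hνb
    refine fun hνa => (hs i).notMem_choice hsub ha hchoice ?_
    rwa [hν.2 i, Matching.mem_at]

theorem Stable.deferredAcceptance_rel (hs : ∀ i, (C i).Substitutable) (hν : Stable C R ν) (a : A) :
    (R a).rel (deferredAcceptance C R a) (ν a) := by
  rw [deferredAcceptance_eq_proposal]
  rcases h : ν a with _ | i
  · exact proposal_rel_none R _ a
  · exact proposal_rel_some R fun hr => hν.ne_of_mem_rejected hs hr h

theorem Matching.card_matched (μ : Matching A I) :
    (Finset.univ.filter fun a => μ a ≠ none).card = ∑ i, (μ.at i).card := by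
  rw [← Finset.card_biUnion]
  · congr 1
    ext a
    simp [Matching.mem_at, Option.ne_none_iff_exists']
  · intro i _ j _ hij
    refine Finset.disjoint_left.2 fun a hi hj => hij (Option.some.inj ?_)
    rw [← Matching.mem_at.1 hi, Matching.mem_at.1 hj]

theorem Stable.deferredAcceptance_eq_none_iff (hs : ∀ i, (C i).Substitutable)
    (hm : ∀ i, (C i).SizeMonotone) (hν : Stable C R ν) (a : A) :
    deferredAcceptance C R a = none ↔ ν a = none := by
  have hμ := stable_deferredAcceptance hs hm R
  have hrel := hν.deferredAcceptance_rel hs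
  have hsub : (Finset.univ.filter fun b => ν b ≠ none) ⊆
      Finset.univ.filter fun b => deferredAcceptance C R b ≠ none := fun b hb => by
    simp only [Finset.mem_filter, Finset.mem_univ, true_and] at hb ⊢
    exact fun h => hb ((R b).antisymm _ _ (hν.1 b) (h ▸ hrel b))
  have hcard : (Finset.univ.filter fun b => deferredAcceptance C R b ≠ none).card ≤
      (Finset.univ.filter fun b => ν b ≠ none).card := by
    rw [Matching.card_matched, Matching.card_matched]
    refine Finset.sum_le_sum fun i _ => ?_
    rw [← hμ.2 i, ← hν.2 i]
    exact hm i (demand_subset_demand hrel i)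
  have := Finset.ext_iff.1 (Finset.eq_of_subset_of_card_le hsub hcard) a
  simp only [Finset.mem_filter, Finset.mem_univ, true_and] at this
  exact (not_iff_not.1 this).symm

end DeferredAcceptance

section Shortlist

variable {A I : Type*} [Fintype A] [Finite I] {C : I → ChoiceRule A} {R : Problem A I}
  {μ ν : Matching A I} {a : A} {i : I}

/-- The rural hospitals theorem. -/
theorem Stable.eq_none_iff (hs : ∀ i, (C i).Substitutable) (hm : ∀ i, (C i).SizeMonotone)
    (hμ : Stable C R μ) (hν : Stable C R ν) (a : A) : μ a = none ↔ ν a = none := by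
  cases nonempty_fintype I
  exact (hμ.deferredAcceptance_eq_none_iff hs hm a).symm.trans
    (hν.deferredAcceptance_eq_none_iff hs hm a)

theorem Stable.eq_some_of_stable_shortlist (hs : ∀ i, (C i).Substitutable)
    (hm : ∀ i, (C i).SizeMonotone) {q : Ranking (Option I)} (hν : Stable C R ν)
    (hνa : ν a = some i) (hμ : Stable C (Function.update R a (q.shortlist {i})) μ) :
    μ a = some i := by
  have hν' : Stable C (Function.update R a (q.shortlist {i})) ν := by
    refine hν.update hs hm ?_ fun j hj => ?_
    · rw [hνa, Ranking.shortlist_rel_none, Set.mem_singleton_iff]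
    · rw [hνa, Ranking.shortlist_rel_some _ (Set.mem_singleton i)] at hj
      rw [hνa, Set.mem_singleton_iff.1 hj.1]
      exact (R a).refl _
  have hir := hμ.1 a
  rw [Function.update_self] at hir
  rcases hμa : μ a with _ | j
  · rw [(hμ.eq_none_iff hs hm hν' a).1 hμa] at hνa
    exact hνa
  · rw [hμa, Ranking.shortlist_rel_none, Set.mem_singleton_iff] at hir
    rw [hir]

theorem Stable.exists_eq_some_of_stable_shortlist (hs : ∀ i, (C i).Substitutable)
    (hm : ∀ i, (C i).SizeMonotone) {q : Ranking (Option I)} {U : Set I} (hν : Stable C R ν)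
    (hνa : ν a = some i) (hi : i ∈ U) (hμ : Stable C (Function.update R a (q.shortlist U)) μ) :
    ∃ j ∈ U, μ a = some j := by
  rcases hμa : μ a with _ | j
  · have hμ' := hμ.update hs hm (p := q.shortlist {i}) (a := a) (hμa ▸ Ranking.refl _ _)
      fun j hj => by
        rw [hμa, Ranking.shortlist_rel_none, Set.mem_singleton_iff] at hj
        rwa [hμa, Function.update_self, Ranking.shortlist_rel_none, hj]
    rw [Function.update_idem] at hμ'
    simp [hν.eq_some_of_stable_shortlist hs hm hνa hμ'] at hμa
  · have hir := hμ.1 a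
    rw [hμa, Function.update_self, Ranking.shortlist_rel_none] at hir
    exact ⟨j, hir, rfl⟩

end Shortlist

section StrategyProofness

variable {A I : Type*} [Fintype A] [Fintype I] {C : I → ChoiceRule A}

/-- After a profitable misreport with outcome `i`, shorten the true list to the schools weakly above
`i`: the student is still matched, and since only schools below the match have been dropped, the
match is stable for the true list as well. -/
theorem strategyProof_deferredAcceptance (hs : ∀ i, (C i).Substitutable)
    (hm : ∀ i, (C i).SizeMonotone) : StrategyProof (deferredAcceptance C) := by
  intro R a p
  have hir := (stable_deferredAcceptance hs hm R).1 a
  rcases hi : deferredAcceptance C (Function.update R a p) a with _ | i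
  · exact hir
  by_cases hnone : (R a).rel none (some i)
  · exact (R a).trans _ _ _ hir hnone
  let U : Set I := {j | (R a).rel (some j) (some i)}
  have hμ := stable_deferredAcceptance hs hm (Function.update R a ((R a).shortlist U))
  obtain ⟨j, hjU, hj⟩ := (stable_deferredAcceptance hs hm
    (Function.update R a p)).exists_eq_some_of_stable_shortlist hs hm hi (U := U)
    ((R a).refl _) (by rwa [Function.update_idem])
  have hμ' := hμ.update hs hm (a := a) (p := R a)
    (hj ▸ (R a).trans _ _ _ hjU ((R a).rel_of_not_rel hnone)) fun k hk => by
      rw [hj] at hk ⊢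
      rw [Function.update_self, Ranking.shortlist_rel_some _ hjU]
      exact ⟨(R a).trans _ _ _ hk hjU, hk⟩
  rw [Function.update_idem, Function.update_eq_self] at hμ'
  exact (R a).trans _ _ _ (hj ▸ hμ'.deferredAcceptance_rel hs a) hjU

theorem forall_stable_and_strategyProof_iff (hs : ∀ i, (C i).Substitutable)
    (hm : ∀ i, (C i).SizeMonotone) {φ : Problem A I → Matching A I} :
    (∀ R, Stable C R (φ R)) ∧ StrategyProof φ ↔ φ = deferredAcceptance C := by
  refine ⟨fun ⟨hφ, hsp⟩ => funext₂ fun R a => ?_, ?_⟩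
  · refine (R a).antisymm _ _ ?_ ((hφ R).deferredAcceptance_rel hs a)
    rcases hi : deferredAcceptance C R a with _ | i
    · exact (hφ R).1 a
    · have hsp_shortlist := hsp R a ((R a).shortlist {i})
      rwa [(stable_deferredAcceptance hs hm R).eq_some_of_stable_shortlist hs hm hi (hφ _)]
        at hsp_shortlist
  · rintro rfl
    exact ⟨stable_deferredAcceptance hs hm, strategyProof_deferredAcceptance hs hm⟩

end StrategyProofness

/-! ### Transversal matroids -/

section Matchable

variable {α β : Type*} {r : α → β → Prop} {X Y : Finset α}

/-- Independence in the transversal matroid of the relation `r`: the members of `X` can be matched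
with distinct elements of `β` that are related to them. -/
def Matchable (r : α → β → Prop) (X : Finset α) : Prop :=
  ∃ f : {a // a ∈ X} → β, Function.Injective f ∧ ∀ a : {a // a ∈ X}, r a (f a)

theorem matchable_empty : Matchable r ∅ :=
  ⟨isEmptyElim, Function.injective_of_subsingleton _, isEmptyElim⟩

theorem Matchable.subset (hY : Matchable r Y) (h : X ⊆ Y) : Matchable r X := by
  obtain ⟨f, f_inj, hf⟩ := hY
  exact ⟨fun a => f ⟨a, h a.2⟩, fun a b hab => Subtype.ext (Subtype.mk.inj (f_inj hab)),
    fun a => hf ⟨a, h a.2⟩⟩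

theorem matchable_iff_exists_injOn [Nonempty β] :
    Matchable r X ↔ ∃ f : α → β, Set.InjOn f X ∧ ∀ a ∈ X, r a (f a) := by
  constructor
  · rintro ⟨f, f_inj, hf⟩
    refine ⟨fun a => if h : a ∈ X then f ⟨a, h⟩ else Classical.arbitrary β, fun a ha b hb hab => ?_,
      fun a ha => by simpa only [dif_pos ha] using hf ⟨a, ha⟩⟩
    rw [Finset.mem_coe] at ha hb
    simp only [dif_pos ha, dif_pos hb] at hab
    exact congrArg Subtype.val (f_inj hab)
  · rintro ⟨f, f_inj, hf⟩
    exact ⟨fun a => f a, fun a b hab => Subtype.ext (f_inj a.2 b.2 hab), fun a => hf a a.2⟩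

theorem injOn_update_insert {f : α → β} {s : Set α} {a : α} {b : β} (hf : Set.InjOn f s)
    (hb : ∀ x ∈ s, f x ≠ b) : Set.InjOn (Function.update f a b) (insert a s) := by
  intro x hx y hy hxy
  rcases eq_or_ne a x with rfl | hax <;> rcases eq_or_ne a y with rfl | hay
  · rfl
  · simp only [Function.update_self, Function.update_of_ne hay.symm] at hxy
    exact absurd hxy.symm (hb y (hy.resolve_left hay.symm))
  · simp only [Function.update_self, Function.update_of_ne hax.symm] at hxy
    exact absurd hxy (hb x (hx.resolve_left hax.symm))
  · simp only [Function.update_of_ne hax.symm, Function.update_of_ne hay.symm] at hxy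
    exact hf (hx.resolve_left hax.symm) (hy.resolve_left hay.symm) hxy

theorem Matchable.exists_insert (hX : Matchable r X) (hY : Matchable r Y)
    (hXY : X.card < Y.card) : ∃ a ∈ Y, a ∉ X ∧ Matchable r (insert a X) := by
  obtain ⟨a₀, ha₀⟩ : Y.Nonempty := Finset.card_pos.1 (by omega)
  have : Nonempty β := ⟨hY.choose ⟨a₀, ha₀⟩⟩
  rw [matchable_iff_exists_injOn] at hX hY
  obtain ⟨g, g_inj, hg⟩ := hY
  obtain ⟨f, f_inj, hf⟩ := hX
  induction hn : (X.filter fun a => f a ≠ g a).card using Nat.strong_induction_on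
    generalizing f with | _ n ih =>
  obtain ⟨s, hsY, hsX⟩ : ∃ s ∈ Y.image g, s ∉ X.image f := by
    refine Finset.exists_mem_notMem_of_card_lt_card ?_
    rwa [Finset.card_image_of_injOn f_inj, Finset.card_image_of_injOn g_inj]
  obtain ⟨a, haY, rfl⟩ := Finset.mem_image.1 hsY
  have g_ne : ∀ b ∈ X, f b ≠ g a := fun b hb h => hsX (Finset.mem_image.2 ⟨b, hb, h⟩)
  have update_inj : Set.InjOn (Function.update f a (g a)) (insert a X : Finset α) := by
    rw [Finset.coe_insert]
    exact injOn_update_insert f_inj g_ne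
  have update_rel : ∀ b ∈ insert a X, r b (Function.update f a (g a) b) := by
    intro b hb
    rcases eq_or_ne b a with rfl | hba
    · simpa using hg b haY
    · simpa [hba] using hf b (Finset.mem_of_mem_insert_of_ne hb hba)
  by_cases haX : a ∈ X
  · -- Moving `a` to its partner under `g` makes `f` agree with `g` at one more point.
    rw [Finset.insert_eq_of_mem haX] at update_inj update_rel
    refine ih _ ?_ _ update_inj update_rel rfl
    rw [← hn]
    refine Finset.card_lt_card ((Finset.ssubset_iff_of_subset fun b hb => ?_).2 ⟨a, ?_, ?_⟩)
    · simp only [Finset.mem_filter] at hb ⊢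
      refine ⟨hb.1, ?_⟩
      rcases eq_or_ne b a with rfl | hba
      · simp at hb
      · simpa [hba] using hb.2
    · simpa using ⟨haX, g_ne a haX⟩
    · simp
  · exact ⟨a, haY, haX, matchable_iff_exists_injOn.2 ⟨_, update_inj, update_rel⟩⟩

/-- The transversal matroid of a relation `r` between `α` and `β`, possibly of infinite rank: it is
determined by its finite independent sets, which are the matchable ones. -/
def transversalMatroid (r : α → β → Prop) : Matroid α :=
  (IndepMatroid.ofFinset Set.univ (Matchable r) matchable_empty (fun _ _ => Matchable.subset)
    (fun _ _ => Matchable.exists_insert) (fun _ _ => Set.subset_univ _)).matroid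

theorem transversalMatroid_indep_coe :
    (transversalMatroid r).Indep (X : Set α) ↔ Matchable r X := by
  simp [transversalMatroid]

end Matchable

/-! ### A symmetric exchange property of the rank function of a matroid -/

section Exchange

variable {α : Type*} {N : Matroid α} {D W Z : Set α} {x : α}

theorem eRk_insert_eq_add_ite {a : α} {X : Set α} (ha : a ∈ N.E) :
    N.eRk (insert a X) = N.eRk X + if a ∈ N.closure X then 0 else 1 := by
  split_ifs with h
  · rw [← N.eRk_closure_eq (insert a X), N.closure_insert_eq_of_mem_closure h, N.eRk_closure_eq,
      add_zero]
  · exact Matroid.eRk_insert_eq_add_one ⟨ha, h⟩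

theorem eRk_sdiff_add_encard_le (hDW : D ⊆ W) (hW : W ⊆ N.E)
    (hD : ∀ y ∈ D, y ∉ N.closure (W \ {y})) : N.eRk (W \ D) + D.encard ≤ N.eRk W := by
  obtain ⟨I, hI⟩ := N.exists_isBasis (W \ D) (Set.sdiff_subset.trans hW)
  obtain ⟨B, hB, hIB⟩ := hI.indep.subset_isBasis_of_subset (hI.subset.trans Set.sdiff_subset)
  have hDB : D ⊆ B := by
    intro y hy
    by_contra hyB
    exact hD y hy (N.closure_subset_closure (Set.subset_sdiff_singleton hB.subset hyB)
      (hB.subset_closure (hDW hy)))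
  rw [← hI.encard_eq_eRk, ← hB.encard_eq_eRk,
    ← Set.encard_union_eq (Set.disjoint_of_subset_left hI.subset Set.disjoint_sdiff_left)]
  exact Set.encard_le_encard (Set.union_subset hIB hDB)

theorem exists_notMem_closure_or_mem_closure (hW : W ⊆ N.E) (hWfin : W.Finite)
    (hZW : Z.encard ≤ W.encard) (hZ : Z ⊆ N.E) (hxZ : x ∈ Z) (hxW : x ∉ W) :
    ∃ y ∈ W \ Z, y ∉ N.closure (Z \ {x}) ∨ y ∈ N.closure (W \ {y}) := by
  by_contra! h
  have hWcl : W ⊆ N.closure (Z \ {x}) := by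
    intro y hy
    by_cases hyZ : y ∈ Z
    · exact N.subset_closure (Z \ {x}) (Set.sdiff_subset.trans hZ) ⟨hyZ, fun e => hxW (e ▸ hy)⟩
    · exact (h y ⟨hy, hyZ⟩).1
  have hrank : N.eRk (W ∩ Z) + (W \ Z).encard ≤ N.eRk (W ∩ Z) + ((Z \ W) \ {x}).encard := calc
    _ = N.eRk (W \ (W \ Z)) + (W \ Z).encard := by rw [Set.sdiff_sdiff_right_self]
    _ ≤ N.eRk W := eRk_sdiff_add_encard_le Set.sdiff_subset hW fun y hy => (h y hy).2
    _ ≤ N.eRk (Z \ {x}) := (N.eRk_mono hWcl).trans_eq (N.eRk_closure_eq _)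
    _ ≤ N.eRk (W ∩ Z ∪ (Z \ W) \ {x}) := N.eRk_mono (by intro y; simp; tauto)
    _ ≤ _ := N.eRk_union_le_eRk_add_encard _ _
  have hfin : N.eRk (W ∩ Z) ≠ ⊤ :=
    ((N.eRk_le_encard _).trans_lt (hWfin.inter_of_left Z).encard_lt_top).ne
  have hZWfin : (Z \ W).Finite := (Set.finite_of_encard_le_coe
    (hZW.trans_eq hWfin.cast_ncard_eq.symm)).sdiff
  have hlt : ((Z \ W) \ {x}).encard < (Z \ W).encard :=
    (hZWfin.subset Set.sdiff_subset).encard_lt_encard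
      (Set.sdiff_singleton_ssubset.2 ⟨hxZ, hxW⟩)
  exact hlt.not_ge (((Set.encard_le_encard_iff_encard_sdiff_le_encard_sdiff
    (hWfin.inter_of_right Z)).1 hZW).trans ((ENat.add_le_add_iff_left hfin).1 hrank))

theorem exists_mem_sdiff_notMem_closure (hx : x ∈ N.closure W) (hxW : x ∉ W)
    (hxZ : x ∉ N.closure (Z \ {x})) (hZ : Z ⊆ N.E) :
    ∃ y ∈ W \ Z, y ∉ N.closure (Z \ {x}) ∧ (x ∈ N.closure (W \ {y}) → y ∈ N.closure (W \ {y})) := by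
  obtain ⟨C, hCW, hC, hxC⟩ := Matroid.exists_isCircuit_of_mem_closure hx hxW
  obtain ⟨y, ⟨hyC, hyx⟩, hy⟩ : ∃ y ∈ C \ {x}, y ∉ N.closure (Z \ {x}) := by
    by_contra! h
    exact hxZ (N.closure_subset_closure_of_subset_closure h
      (hC.mem_closure_sdiff_singleton_of_mem hxC))
  have hyW : y ∈ W := (hCW hyC).resolve_left hyx
  have hyZ : y ∉ Z := fun h => hy (N.subset_closure _ (Set.sdiff_subset.trans hZ) ⟨h, hyx⟩)
  refine ⟨y, ⟨hyW, hyZ⟩, hy, fun hxy => ?_⟩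
  rw [← N.closure_insert_eq_of_mem_closure hxy]
  refine N.closure_subset_closure ?_ (hC.mem_closure_sdiff_singleton_of_mem hyC)
  rintro z ⟨hz, hzy⟩
  exact (hCW hz).imp id fun hzW => ⟨hzW, hzy⟩

theorem exists_eRk_exchange (hW : W ⊆ N.E) (hWfin : W.Finite) (hZW : Z.encard ≤ W.encard)
    (hZ : Z ⊆ N.E) (hxZ : x ∈ Z) (hxW : x ∉ W) :
    ∃ y ∈ W \ Z,
      N.eRk Z + N.eRk W ≤ N.eRk (insert y (Z \ {x})) + N.eRk (insert x (W \ {y})) := by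
  -- The four ranks exceed those of `Z \ {x}` and `W \ {y}` by 0 or 1, according to membership in
  -- closures, so it is enough to pair off the cases of an excess 1 in one of two ways.
  obtain ⟨y, hy, hcl⟩ : ∃ y ∈ W \ Z,
      ((x ∉ N.closure (Z \ {x}) → y ∉ N.closure (Z \ {x})) ∧
        (y ∉ N.closure (W \ {y}) → x ∉ N.closure (W \ {y}))) ∨
      ((x ∉ N.closure (Z \ {x}) → x ∉ N.closure (W \ {y})) ∧
        (y ∉ N.closure (W \ {y}) → y ∉ N.closure (Z \ {x}))) := by
    by_cases h : x ∈ N.closure W ∧ x ∉ N.closure (Z \ {x})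
    · obtain ⟨y, hy, hyZ, hyW⟩ := exists_mem_sdiff_notMem_closure h.1 hxW h.2 hZ
      exact ⟨y, hy, Or.inl ⟨fun _ => hyZ, mt hyW⟩⟩
    · obtain ⟨y, hy, hcl⟩ := exists_notMem_closure_or_mem_closure hW hWfin hZW hZ hxZ hxW
      have := @N.closure_subset_closure _ (W \ {y}) W Set.sdiff_subset x
      exact ⟨y, hy, Or.inr ⟨by tauto, by tauto⟩⟩
  refine ⟨y, hy, ?_⟩
  have eRk_eq : ∀ {a : α} {X : Set α}, a ∈ X → X ⊆ N.E →
      N.eRk X = N.eRk (X \ {a}) + if a ∈ N.closure (X \ {a}) then 0 else 1 := fun ha hX => by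
    rw [← eRk_insert_eq_add_ite (hX ha), Set.insert_sdiff_self_of_mem ha]
  rw [eRk_eq hxZ hZ, eRk_eq hy.1 hW, eRk_insert_eq_add_ite (hW hy.1),
    eRk_insert_eq_add_ite (hZ hxZ)]
  refine (add_add_add_comm _ _ _ _).trans_le
    ((add_le_add le_rfl ?_).trans_eq (add_add_add_comm _ _ _ _))
  split_ifs <;> simp_all

end Exchange

/-! ### The choice of a school -/

namespace Market

section Rank

variable {A I T : Type*} (M : Market A I T) (i : I) {X Y Z W : Finset A}

/-- The transversal matroid of school `i`, in which a student is related to the reserved seats for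
the traits of the student. -/
def reserveMatroid : Matroid A :=
  transversalMatroid fun a (s : M.Seat i) => s.1 ∈ M.traits a

theorem subset_reserveMatroid_ground (S : Set A) : S ⊆ (M.reserveMatroid i).E :=
  Set.subset_univ S

theorem subset_closure_reserveMatroid (S : Set A) : S ⊆ (M.reserveMatroid i).closure S :=
  Matroid.subset_closure _ _ (M.subset_reserveMatroid_ground i S)

theorem reserveMatroid_indep_coe : (M.reserveMatroid i).Indep (X : Set A) ↔ M.Indep i X :=
  transversalMatroid_indep_coe

theorem coe_rank (X : Finset A) : (M.rank i X : ℕ∞) = (M.reserveMatroid i).eRk X := by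
  refine le_antisymm ?_ (Matroid.eRk_le_iff.2 fun J hJX hJ => ?_)
  · obtain ⟨J, hJ, hrank⟩ := Finset.exists_mem_eq_sup (X.powerset.filter (M.Indep i))
      ⟨∅, by simp [← reserveMatroid_indep_coe]⟩ Finset.card
    rw [Finset.mem_filter, Finset.mem_powerset, ← reserveMatroid_indep_coe] at hJ
    rw [rank, hrank, ← Set.encard_coe_eq_coe_finsetCard]
    exact hJ.2.encard_le_eRk_of_subset (Finset.coe_subset.2 hJ.1)
  · lift J to Finset A using X.finite_toSet.subset hJX
    rw [Set.encard_coe_eq_coe_finsetCard, Nat.cast_le]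
    refine Finset.le_sup (f := Finset.card) (Finset.mem_filter.2 ⟨?_, ?_⟩)
    · exact Finset.mem_powerset.2 (Finset.coe_subset.1 hJX)
    · exact (M.reserveMatroid_indep_coe i).1 hJ

theorem rank_le_of_subset_closure (h : (X : Set A) ⊆ (M.reserveMatroid i).closure Y) :
    M.rank i X ≤ M.rank i Y := by
  rw [← Nat.cast_le (α := ℕ∞), coe_rank, coe_rank, ← Matroid.eRk_closure_eq _ (Y : Set A)]
  exact Matroid.eRk_mono _ h

theorem rank_mono (h : X ⊆ Y) : M.rank i X ≤ M.rank i Y :=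
  M.rank_le_of_subset_closure i ((Finset.coe_subset.2 h).trans
    (M.subset_closure_reserveMatroid i _))

theorem rank_insert_eq_add_one_iff {a : A} :
    M.rank i (insert a Y) = M.rank i Y + 1 ↔ a ∉ (M.reserveMatroid i).closure Y := by
  rw [← Nat.cast_inj (R := ℕ∞), Nat.cast_add, coe_rank, Finset.coe_insert,
    eRk_insert_eq_add_ite (Set.mem_univ a), ← coe_rank]
  norm_cast
  split_ifs with h <;> simp [h]

theorem rank_add_card_le (h : X ⊆ Y) : M.rank i Y + X.card ≤ M.rank i X + Y.card := by
  have hrank : M.rank i Y ≤ M.rank i X + (Y \ X).card := by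
    rw [← Nat.cast_le (α := ℕ∞), Nat.cast_add, coe_rank, coe_rank,
      ← Set.encard_coe_eq_coe_finsetCard]
    calc
      _ = (M.reserveMatroid i).eRk (X ∪ ↑(Y \ X)) := by
        rw [← Finset.coe_union, Finset.union_sdiff_of_subset h]
      _ ≤ _ := Matroid.eRk_union_le_eRk_add_encard _ _ _
  have := Finset.card_sdiff_add_card_eq_card h
  omega

theorem rank_le_sum_reserve [Fintype T] (X : Finset A) : M.rank i X ≤ ∑ t, M.reserve i t := by
  refine Finset.sup_le fun Y hY => ?_
  obtain ⟨f, f_inj, -⟩ := (Finset.mem_filter.1 hY).2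
  simpa using Fintype.card_le_of_injective f f_inj

theorem exists_rank_exchange {x : A} (hZW : Z.card ≤ W.card) (hxZ : x ∈ Z) (hxW : x ∉ W) :
    ∃ y ∈ W \ Z,
      M.rank i Z + M.rank i W ≤ M.rank i ((Z \ {x}) ∪ {y}) + M.rank i ((W \ {y}) ∪ {x}) := by
  obtain ⟨y, hy, hrank⟩ := exists_eRk_exchange (N := M.reserveMatroid i) (x := x)
    (M.subset_reserveMatroid_ground i W) W.finite_toSet
    (by simpa only [Set.encard_coe_eq_coe_finsetCard, Nat.cast_le] using hZW)
    (M.subset_reserveMatroid_ground i Z) hxZ hxW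
  refine ⟨y, by simpa using hy, ?_⟩
  rw [← Nat.cast_le (α := ℕ∞)]
  push_cast [coe_rank]
  simpa only [Set.union_singleton] using hrank

end Rank

section ExchangeOptimal

variable {A I T : Type*} {M : Market A I T} {i : I} {X Y Z W : Finset A}

variable (M i X Z) in
/-- Optimality of the set `Z` chosen from `X` by school `i` against the exchange of a single
student: utilization of the reserves comes first, priority second. Applied to the demand for each
school, it sums up the axioms on a matching other than individual rationality. -/
structure IsExchangeOptimal : Prop where
  subset : Z ⊆ X
  returning_subset : X ∩ M.returning i ⊆ Z
  card_le : Z.card ≤ M.capacity i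
  card_eq : ∀ a ∈ X \ Z, Z.card = M.capacity i
  rank_le : ∀ a ∈ X \ Z, ∀ b ∈ Z \ M.returning i, M.rank i ((Z \ {b}) ∪ {a}) ≤ M.rank i Z
  rank_lt : ∀ a ∈ X \ Z, ∀ b ∈ Z \ M.returning i, (M.priority i).strict a b →
    M.rank i ((Z \ {b}) ∪ {a}) < M.rank i Z

theorem IsExchangeOptimal.inter_subset (hXY : X ⊆ Y) (hZ : M.IsExchangeOptimal i X Z)
    (hW : M.IsExchangeOptimal i Y W) : W ∩ X ⊆ Z := by
  intro x hx
  obtain ⟨hxW, hxX⟩ := Finset.mem_inter.1 hx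
  by_contra hxZ
  have hxXZ : x ∈ X \ Z := Finset.mem_sdiff.2 ⟨hxX, hxZ⟩
  obtain ⟨y, hy, hrank⟩ :=
    M.exists_rank_exchange i (hW.card_le.trans_eq (hZ.card_eq x hxXZ).symm) hxW hxZ
  obtain ⟨hyZ, hyW⟩ := Finset.mem_sdiff.1 hy
  have hyY : y ∈ Y := hXY (hZ.subset hyZ)
  have hyYW : y ∈ Y \ W := Finset.mem_sdiff.2 ⟨hyY, hyW⟩
  have hxWr : x ∈ W \ M.returning i := Finset.mem_sdiff.2
    ⟨hxW, fun h => hxZ (hZ.returning_subset (Finset.mem_inter.2 ⟨hxX, h⟩))⟩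
  have hyZr : y ∈ Z \ M.returning i := Finset.mem_sdiff.2
    ⟨hyZ, fun h => hyW (hW.returning_subset (Finset.mem_inter.2 ⟨hyY, h⟩))⟩
  have hxy : x ≠ y := fun h => hxZ (h ▸ hyZ)
  -- Neither exchange raises the rank, so by `hrank` both keep it, and priority rules one out.
  have hW_le := hW.rank_le y hyYW x hxWr
  have hZ_le := hZ.rank_le x hxXZ y hyZr
  rcases (M.priority i).total x y with h | h
  · have := hZ.rank_lt x hxXZ y hyZr ⟨h, hxy⟩
    omega
  · have := hW.rank_lt y hyYW x hxWr ⟨h, hxy.symm⟩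
    omega

theorem IsExchangeOptimal.unique (hZ : M.IsExchangeOptimal i X Z)
    (hW : M.IsExchangeOptimal i X W) : Z = W := by
  refine Finset.Subset.antisymm ?_ ?_
  · simpa only [Finset.inter_eq_left.2 hZ.subset] using hW.inter_subset subset_rfl hZ
  · simpa only [Finset.inter_eq_left.2 hW.subset] using hZ.inter_subset subset_rfl hW

theorem IsExchangeOptimal.card_mono (hXY : X ⊆ Y) (hZ : M.IsExchangeOptimal i X Z)
    (hW : M.IsExchangeOptimal i Y W) : Z.card ≤ W.card := by
  by_cases hYW : Y ⊆ W
  · exact Finset.card_le_card ((hZ.subset.trans hXY).trans hYW)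
  · obtain ⟨a, haY, haW⟩ := Finset.not_subset.1 hYW
    exact hZ.card_le.trans_eq (hW.card_eq a (Finset.mem_sdiff.2 ⟨haY, haW⟩)).symm

end ExchangeOptimal

section Steps

variable {A I T : Type*} {M : Market A I T} {i : I} {X B Y : Finset A}

theorem iterate_done_or_le {S : Type*} {f : S → S} {m : S → ℕ} {Done : S → Prop}
    (h : ∀ y, (Done y ∧ f y = y) ∨ m y < m (f y)) (n : ℕ) (y : S) :
    Done (f^[n] y) ∨ n ≤ m (f^[n] y) := by
  suffices (Done (f^[n] y) ∧ f (f^[n] y) = f^[n] y) ∨ n ≤ m (f^[n] y) from this.imp_left And.left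
  induction n with
  | zero => exact Or.inr (Nat.zero_le _)
  | succ n ih =>
    rw [Function.iterate_succ_apply']
    rcases h (f^[n] y) with hdone | hlt
    · exact Or.inl (by rwa [hdone.2])
    · rcases ih with hdone | hle
      · exact Or.inl (by rwa [hdone.2])
      · exact Or.inr (hle.trans_lt hlt)

theorem reserveStep_eq_self_or_insert (M : Market A I T) (i : I) (X Y : Finset A) :
    ((M.capacity i ≤ Y.card ∨ (X : Set A) ⊆ (M.reserveMatroid i).closure Y) ∧
      M.reserveStep i X Y = Y) ∨
    ∃ b ∈ X, Y.card < M.capacity i ∧ b ∉ (M.reserveMatroid i).closure Y ∧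
      (∀ z ∈ X, z ∉ (M.reserveMatroid i).closure Y → (M.priority i).rel b z) ∧
      M.reserveStep i X Y = insert b Y := by
  have mem_filter : ∀ z, z ∈ ((X \ Y).filter fun a => M.rank i (insert a Y) = M.rank i Y + 1) ↔
      z ∈ X ∧ z ∉ (M.reserveMatroid i).closure Y := by
    intro z
    rw [Finset.mem_filter, Finset.mem_sdiff, rank_insert_eq_add_one_iff, and_assoc]
    refine and_congr_right fun _ => and_iff_right_of_imp (mt fun hz => ?_)
    exact M.subset_closure_reserveMatroid i Y hz
  unfold reserveStep
  split_ifs with h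
  · obtain ⟨hbX, hb⟩ := (mem_filter _).1 ((M.priority i).best_mem _ h.2)
    exact Or.inr ⟨_, hbX, h.1, hb,
      fun z hzX hz => (M.priority i).best_rel _ h.2 z ((mem_filter z).2 ⟨hzX, hz⟩), rfl⟩
  · refine Or.inl ⟨(not_and_or.1 h).imp not_lt.1 fun hempty z hz => ?_, rfl⟩
    by_contra hzY
    exact hempty ⟨z, (mem_filter z).2 ⟨hz, hzY⟩⟩

theorem fillStep_eq_self_or_insert (M : Market A I T) (i : I) (X Y : Finset A) :
    ((M.capacity i ≤ Y.card ∨ X ⊆ Y) ∧ M.fillStep i X Y = Y) ∨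
    ∃ b ∈ X \ Y, Y.card < M.capacity i ∧ (∀ z ∈ X \ Y, (M.priority i).rel b z) ∧
      M.fillStep i X Y = insert b Y := by
  unfold fillStep
  split_ifs with h
  · exact Or.inr ⟨_, (M.priority i).best_mem _ h.2, h.1, (M.priority i).best_rel _ h.2, rfl⟩
  · exact Or.inl ⟨(not_and_or.1 h).imp not_lt.1 fun hempty =>
      Finset.sdiff_eq_empty_iff_subset.1 (Finset.not_nonempty_iff_eq_empty.1 hempty), rfl⟩

variable (M i X Y) in
/-- The properties of the set `Y` chosen so far from `X` that Step 2 of the guaranteed-enrollment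
choice rule preserves. -/
structure ReserveInvariant : Prop where
  subset : Y ⊆ X
  returning_subset : X ∩ M.returning i ⊆ Y
  card_le : Y.card ≤ M.capacity i
  rank_add_card : M.rank i Y + (X ∩ M.returning i).card = M.rank i (X ∩ M.returning i) + Y.card
  mem_closure : ∀ y ∈ Y \ M.returning i, ∀ z ∈ X \ Y, (M.priority i).strict z y →
    z ∈ (M.reserveMatroid i).closure (Y \ {y} : Finset A)

theorem reserveInvariant_inter_returning (M : Market A I T) (i : I) (X : Finset A) :
    M.ReserveInvariant i X (X ∩ M.returning i) where
  subset := Finset.inter_subset_left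
  returning_subset := subset_rfl
  card_le := (Finset.card_le_card Finset.inter_subset_right).trans (M.card_returning_le i)
  rank_add_card := rfl
  mem_closure _ hy :=
    absurd (Finset.mem_inter.1 (Finset.mem_sdiff.1 hy).1).2 (Finset.mem_sdiff.1 hy).2

theorem ReserveInvariant.reserveStep (h : M.ReserveInvariant i X Y) :
    M.ReserveInvariant i X (M.reserveStep i X Y) := by
  obtain ⟨-, hY⟩ | ⟨b, hbX, hcard, hb, hbest, hY⟩ := M.reserveStep_eq_self_or_insert i X Y
  · rwa [hY]
  have hbY : b ∉ Y := fun hbY => hb (M.subset_closure_reserveMatroid i Y hbY)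
  have hrank := (M.rank_insert_eq_add_one_iff i).2 hb
  have hcard_insert := Finset.card_insert_of_notMem hbY
  have hrank_add_card := h.rank_add_card
  rw [hY]
  refine ⟨Finset.insert_subset hbX h.subset, h.returning_subset.trans (Finset.subset_insert b Y),
    by omega, by omega, fun y hy z hz hzy => ?_⟩
  obtain ⟨hyY, hyr⟩ := Finset.mem_sdiff.1 hy
  obtain ⟨hzX, hzY⟩ := Finset.mem_sdiff.1 hz
  rcases eq_or_ne y b with rfl | hyb
  · rw [Finset.sdiff_singleton_eq_erase, Finset.erase_insert hbY]
    by_contra hzcl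
    exact hzy.not_rel (hbest z hzX hzcl)
  · have hzcl := h.mem_closure y
      (Finset.mem_sdiff.2 ⟨Finset.mem_of_mem_insert_of_ne hyY hyb, hyr⟩) z
      (Finset.mem_sdiff.2 ⟨hzX, fun hzY' => hzY (Finset.mem_insert_of_mem hzY')⟩) hzy
    refine (M.reserveMatroid i).closure_subset_closure ?_ hzcl
    exact Finset.coe_subset.2 (Finset.sdiff_subset_sdiff (Finset.subset_insert b Y) subset_rfl)

variable (M i X B Y) in
/-- The properties of the set `Y` chosen so far from `X` that Step 3 of the guaranteed-enrollment
choice rule preserves when it starts from the set `B`. -/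
structure FillInvariant : Prop where
  subset : Y ⊆ X
  base_subset : B ⊆ Y
  card_le : Y.card ≤ M.capacity i
  rel : ∀ y ∈ Y \ B, ∀ z ∈ X \ Y, (M.priority i).rel y z

theorem FillInvariant.fillStep (h : M.FillInvariant i X B Y) :
    M.FillInvariant i X B (M.fillStep i X Y) := by
  obtain ⟨-, hY⟩ | ⟨b, hb, hcard, hbest, hY⟩ := M.fillStep_eq_self_or_insert i X Y
  · rwa [hY]
  obtain ⟨hbX, hbY⟩ := Finset.mem_sdiff.1 hb
  have hcard_insert := Finset.card_insert_of_notMem hbY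
  rw [hY]
  refine ⟨Finset.insert_subset hbX h.subset, h.base_subset.trans (Finset.subset_insert b Y),
    by omega, fun y hy z hz => ?_⟩
  obtain ⟨hyY, hyB⟩ := Finset.mem_sdiff.1 hy
  have hzXY : z ∈ X \ Y := Finset.sdiff_subset_sdiff subset_rfl (Finset.subset_insert b Y) hz
  rcases Finset.mem_insert.1 hyY with rfl | hyY
  · exact hbest z hzXY
  · exact h.rel y (Finset.mem_sdiff.2 ⟨hyY, hyB⟩) z hzXY

theorem capacity_le_or_rank_le_iterate_reserveStep [Fintype T] (M : Market A I T) (i : I)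
    (X Y : Finset A) :
    M.capacity i ≤ ((M.reserveStep i X)^[∑ t, M.reserve i t] Y).card ∨
      M.rank i X ≤ M.rank i ((M.reserveStep i X)^[∑ t, M.reserve i t] Y) := by
  have step_spec : ∀ Y, ((M.capacity i ≤ Y.card ∨ M.rank i X ≤ M.rank i Y) ∧
      M.reserveStep i X Y = Y) ∨ M.rank i Y < M.rank i (M.reserveStep i X Y) := by
    intro Y
    obtain ⟨hdone, hY⟩ | ⟨b, -, -, hb, -, hY⟩ := M.reserveStep_eq_self_or_insert i X Y
    · exact Or.inl ⟨hdone.imp_right (M.rank_le_of_subset_closure i), hY⟩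
    · rw [hY, (M.rank_insert_eq_add_one_iff i).2 hb]
      exact Or.inr (Nat.lt_succ_self _)
  rcases iterate_done_or_le step_spec (∑ t, M.reserve i t) Y with hdone | hrank
  · exact hdone
  · exact Or.inr ((M.rank_le_sum_reserve i X).trans hrank)

theorem capacity_le_or_subset_iterate_fillStep (M : Market A I T) (i : I) (h : Y ⊆ X) :
    M.capacity i ≤ ((M.fillStep i X)^[X.card] Y).card ∨ X ⊆ (M.fillStep i X)^[X.card] Y := by
  have step_spec : ∀ Y, ((M.capacity i ≤ Y.card ∨ X ⊆ Y) ∧ M.fillStep i X Y = Y) ∨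
      Y.card < (M.fillStep i X Y).card := by
    intro Y
    obtain ⟨hdone, hY⟩ | ⟨b, hb, -, -, hY⟩ := M.fillStep_eq_self_or_insert i X Y
    · exact Or.inl ⟨hdone, hY⟩
    · rw [hY, Finset.card_insert_of_notMem (Finset.mem_sdiff.1 hb).2]
      exact Or.inr (Nat.lt_succ_self _)
  rcases iterate_done_or_le step_spec X.card Y with hdone | hcard
  · exact hdone
  · have hsub := iterate_subset (fun _ => M.fillStep_subset i) X.card h
    exact Or.inr (Finset.eq_of_subset_of_card_le hsub hcard).ge

theorem ReserveInvariant.rank_le_of_card_le (hB : M.ReserveInvariant i X B)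
    (h : X ∩ M.returning i ⊆ Y) (hcard : Y.card ≤ B.card) : M.rank i Y ≤ M.rank i B := by
  have := M.rank_add_card_le i h
  have := hB.rank_add_card
  omega

theorem ReserveInvariant.rank_sdiff_singleton_lt (hB : M.ReserveInvariant i X B) {b : A}
    (hb : b ∈ B \ M.returning i) : M.rank i (B \ {b}) < M.rank i B := by
  obtain ⟨hbB, hbr⟩ := Finset.mem_sdiff.1 hb
  have hsub : X ∩ M.returning i ⊆ B \ {b} := fun c hc => Finset.mem_sdiff.2
    ⟨hB.returning_subset hc, fun hcb =>
      hbr (Finset.mem_singleton.1 hcb ▸ (Finset.mem_inter.1 hc).2)⟩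
  have := M.rank_add_card_le i hsub
  have := hB.rank_add_card
  have := Finset.card_sdiff_add_card_eq_card (Finset.singleton_subset_iff.2 hbB)
  rw [Finset.card_singleton] at this
  omega

theorem FillInvariant.rank_exchange_le (hB : M.ReserveInvariant i X B)
    (hfull : M.capacity i ≤ B.card ∨ M.rank i X ≤ M.rank i B) (hY : M.FillInvariant i X B Y)
    {a b : A} (ha : a ∈ X \ Y) (hb : b ∈ Y \ M.returning i) :
    M.rank i ((Y \ {b}) ∪ {a}) ≤ M.rank i Y := by
  obtain ⟨haX, haY⟩ := Finset.mem_sdiff.1 ha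
  obtain ⟨hbY, hbr⟩ := Finset.mem_sdiff.1 hb
  rw [Finset.union_singleton]
  rcases hfull with hcap | hrank
  · obtain rfl : B = Y := Finset.eq_of_subset_of_card_le hY.base_subset (hY.card_le.trans hcap)
    refine hB.rank_le_of_card_le (fun c hc => ?_) ?_
    · have hcb : c ≠ b := fun h => hbr (h ▸ (Finset.mem_inter.1 hc).2)
      simp [hB.returning_subset hc, hcb]
    · rw [Finset.card_insert_of_notMem (fun h => haY (Finset.mem_sdiff.1 h).1),
        Finset.sdiff_singleton_eq_erase, Finset.card_erase_add_one hbY]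
  · calc
      M.rank i (insert a (Y \ {b})) ≤ M.rank i X :=
        M.rank_mono i (Finset.insert_subset haX (Finset.sdiff_subset.trans hY.subset))
      _ ≤ M.rank i B := hrank
      _ ≤ M.rank i Y := M.rank_mono i hY.base_subset

theorem FillInvariant.rank_exchange_lt (hB : M.ReserveInvariant i X B)
    (hY : M.FillInvariant i X B Y) {a b : A} (ha : a ∈ X \ Y) (hb : b ∈ Y \ M.returning i)
    (hab : (M.priority i).strict a b) : M.rank i ((Y \ {b}) ∪ {a}) < M.rank i Y := by
  obtain ⟨haX, haY⟩ := Finset.mem_sdiff.1 ha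
  obtain ⟨hbY, hbr⟩ := Finset.mem_sdiff.1 hb
  have hbB : b ∈ B := by
    by_contra hbB
    exact hab.not_rel (hY.rel b (Finset.mem_sdiff.2 ⟨hbY, hbB⟩) a ha)
  have hbBr : b ∈ B \ M.returning i := Finset.mem_sdiff.2 ⟨hbB, hbr⟩
  have ha_cl : a ∈ (M.reserveMatroid i).closure (B \ {b} : Finset A) :=
    hB.mem_closure b hbBr a (Finset.mem_sdiff.2 ⟨haX, fun h => haY (hY.base_subset h)⟩) hab
  -- The students added in Step 3 outrank `a`, hence `b`, and yet `b` was preferred in Step 2.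
  have fill_cl : ∀ c ∈ Y \ B, c ∈ (M.reserveMatroid i).closure (B \ {b} : Finset A) := by
    intro c hc
    obtain ⟨hcY, hcB⟩ := Finset.mem_sdiff.1 hc
    exact hB.mem_closure b hbBr c (Finset.mem_sdiff.2 ⟨hY.subset hcY, hcB⟩)
      ⟨(M.priority i).trans _ _ _ (hY.rel c hc a ha) hab.1, fun h => hcB (h ▸ hbB)⟩
  calc
    M.rank i ((Y \ {b}) ∪ {a}) ≤ M.rank i (B \ {b}) := by
      refine M.rank_le_of_subset_closure i fun c hc => ?_
      rw [Finset.union_singleton, Finset.mem_coe, Finset.mem_insert, Finset.mem_sdiff] at hc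
      rcases hc with rfl | ⟨hcY, hcb⟩
      · exact ha_cl
      · by_cases hcB : c ∈ B
        · exact M.subset_closure_reserveMatroid i _ (Finset.mem_sdiff.2 ⟨hcB, hcb⟩)
        · exact fill_cl c (Finset.mem_sdiff.2 ⟨hcY, hcB⟩)
    _ < M.rank i B := hB.rank_sdiff_singleton_lt hbBr
    _ ≤ M.rank i Y := M.rank_mono i hY.base_subset

theorem isExchangeOptimal_geChoice [Fintype T] (M : Market A I T) (i : I) (X : Finset A) :
    M.IsExchangeOptimal i X ((M.geChoice i).choice X) := by
  let B := (M.reserveStep i X)^[∑ t, M.reserve i t] (X ∩ M.returning i)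
  have hB : M.ReserveInvariant i X B :=
    Function.Iterate.rec (M.ReserveInvariant i X) (M.reserveInvariant_inter_returning i X)
      (fun _ h => h.reserveStep) _
  have hZ : M.FillInvariant i X B ((M.geChoice i).choice X) :=
    Function.Iterate.rec (M.FillInvariant i X B)
      ⟨hB.subset, subset_rfl, hB.card_le, fun y hy => by simp at hy⟩
      (fun _ h => h.fillStep) _
  have hBfull := M.capacity_le_or_rank_le_iterate_reserveStep i X (X ∩ M.returning i)
  have hZfull := M.capacity_le_or_subset_iterate_fillStep i hB.subset
  exact {
    subset := hZ.subset
    returning_subset := hB.returning_subset.trans hZ.base_subset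
    card_le := hZ.card_le
    card_eq := fun a ha => hZ.card_le.antisymm (hZfull.resolve_right fun h =>
      (Finset.mem_sdiff.1 ha).2 (h (Finset.mem_sdiff.1 ha).1))
    rank_le := fun _ ha _ hb => hZ.rank_exchange_le hB hBfull ha hb
    rank_lt := fun _ ha _ hb hab => hZ.rank_exchange_lt hB ha hb hab }

end Steps

section Characterization

variable {A I T : Type*} (M : Market A I T)

theorem substitutable_geChoice [Fintype T] (i : I) : (M.geChoice i).Substitutable := fun X Y hXY =>
  (M.isExchangeOptimal_geChoice i X).inter_subset hXY (M.isExchangeOptimal_geChoice i Y)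

theorem sizeMonotone_geChoice [Fintype T] (i : I) : (M.geChoice i).SizeMonotone := fun X Y hXY =>
  (M.isExchangeOptimal_geChoice i X).card_mono hXY (M.isExchangeOptimal_geChoice i Y)

variable [Fintype A]

theorem axioms_iff_isExchangeOptimal (R : Problem A I) (μ : Matching A I) :
    (M.GuaranteedEnrollment R μ ∧ M.MaximalUtilization R μ ∧
      M.NoJustifiedEnvyUnderReserves R μ ∧ M.NonWasteful R μ) ↔
    ∀ i, M.IsExchangeOptimal i (demand R μ i) (μ.at i) := by
  refine ⟨fun ⟨hge, hmu, hje, hnw⟩ i => ?_, fun h => ⟨fun i a har hat => ?_, fun i a _ hs => ?_,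
    fun i a _ hs => (h i).rank_lt a (mem_demand_sdiff_at.2 hs),
    fun i => ⟨(h i).card_le, fun a hs => (h i).card_eq a (mem_demand_sdiff_at.2 hs)⟩⟩⟩
  · have strict_of_mem : ∀ a ∈ demand R μ i \ μ.at i, (R a).strict (some i) (μ a) :=
      fun _ => mem_demand_sdiff_at.1
    have notMem_at : ∀ a ∈ demand R μ i \ μ.at i, a ∉ μ.at i := fun _ ha =>
      (Finset.mem_sdiff.1 ha).2
    exact {
      subset := at_subset_demand R μ i
      returning_subset := fun a ha => by
        obtain ⟨had, har⟩ := Finset.mem_inter.1 ha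
        by_contra hat
        exact (hge i a har hat).not_rel (mem_demand.1 had)
      card_le := (hnw i).1
      card_eq := fun a ha => (hnw i).2 a (strict_of_mem a ha)
      rank_le := fun a ha => (hmu i a (notMem_at a ha) (strict_of_mem a ha)).2
        ((hnw i).2 a (strict_of_mem a ha))
      rank_lt := fun a ha => hje i a (notMem_at a ha) (strict_of_mem a ha) }
  · have had : ¬ (R a).rel (some i) (μ a) := fun had =>
      hat ((h i).returning_subset (Finset.mem_inter.2 ⟨mem_demand.2 had, har⟩))
    exact ⟨(R a).rel_of_not_rel had, fun he => hat (Matching.mem_at.2 he)⟩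
  · have ha := mem_demand_sdiff_at.2 hs
    exact ⟨fun hlt => absurd ((h i).card_eq a ha) hlt.ne, fun _ => (h i).rank_le a ha⟩

theorem axioms_iff_stable [Fintype T] (R : Problem A I) (μ : Matching A I) :
    (M.GuaranteedEnrollment R μ ∧ M.MaximalUtilization R μ ∧
      M.NoJustifiedEnvyUnderReserves R μ ∧ M.NonWasteful R μ ∧ IndividuallyRational R μ) ↔
    Stable M.geChoice R μ := by
  have choice_eq_iff : ∀ i, M.IsExchangeOptimal i (demand R μ i) (μ.at i) ↔
      (M.geChoice i).choice (demand R μ i) = μ.at i := fun i =>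
    ⟨(M.isExchangeOptimal_geChoice i _).unique, fun h => h ▸ M.isExchangeOptimal_geChoice i _⟩
  rw [Stable, ← forall_congr' choice_eq_iff, ← axioms_iff_isExchangeOptimal]
  tauto

end Characterization

end Market

end SchoolChoice

end

theorem mainTheorem3 {A I T : Type*} [Fintype A] [Fintype I] [Fintype T]
    (M : Market A I T) (φ : Problem A I → Matching A I) :
    ((∀ R, M.GuaranteedEnrollment R (φ R)) ∧
      (∀ R, M.MaximalUtilization R (φ R)) ∧
      (∀ R, M.NoJustifiedEnvyUnderReserves R (φ R)) ∧
      (∀ R, M.NonWasteful R (φ R)) ∧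
      (∀ R, IndividuallyRational R (φ R)) ∧
      StrategyProof φ) ↔
    φ = deferredAcceptance M.geChoice := by
  rw [← forall_stable_and_strategyProof_iff M.substitutable_geChoice M.sizeMonotone_geChoice]
  simp only [← M.axioms_iff_stable, forall_and, and_assoc]
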